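/- Let $N$ be a smooth Hausdorff manifold without boundary of finite dimension $\dim N\ge 1$, and let $m\ge 1$. Let $F_m(N)\subset N^m$ be the open submanifold of $m$-tuples of pairwise distinct points, let $C_m(N)=F_m(N)/\Sigma_m$ be the unordered $m$-point configuration space, where the symmetric group $\Sigma_m$ permutes the entries, with the smooth structure of the quotient by this free action, and let $\pi:F_m(N)\to C_m(N)$ be the quotient map. Write $H^1$ for first de Rham cohomology (closed smooth $1$-forms modulo differentials of smooth functions). Then there is an injective linear map $\Phi:H^1(N)\to H^1(C_m(N))$ with the following property: for every closed $1$-form $\omega$ on $N$ there is a closed $1$-form $\eta$ on $C_m(N)$ such that $\pi^*\eta=\hat\omega$ and $\Phi([\omega])=[\eta]$, where $\hat\omega=\sum_{i=1}^m \mathrm{pr}_i^*\omega$ is the $\Sigma_m$-invariant $1$-form on $F_m(N)$ given by $\hat\omega_x(v_1,\dots,v_m)=\sum_{i=1}^m\omega_{x_i}(v_i)$ for $x=(x_1,\dots,x_m)\in F_m(N)$ and $v_i\in T_{x_i}N$. -/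

import Mathlib

open scoped Manifold ContDiff Topology Bundle

noncomputable section
namespace DeRham
variable {E : Type*} [NormedAddCommGroup E] [NormedSpace ℝ E] {H : Type*} [TopologicalSpace H]
  (I : ModelWithCorners ℝ E H) (M : Type*) [TopologicalSpace M] [ChartedSpace H M]
  [IsManifold I ∞ M]

/-- Smooth differential `1`-forms on `M`: smooth sections of the cotangent bundle. -/
abbrev OneForm : Type _ :=
  ContMDiffSection I (E →L[ℝ] ℝ) ∞ (fun x : M ↦ TangentSpace I x →L[ℝ] Bundle.Trivial M ℝ x)

variable {I M}

/-- The pullback of a `1`-form to the model vector space along the inverse of the chart at `x`. -/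
def localRep (α : OneForm I M) (x : M) (y : E) : E →L[ℝ] ℝ :=
  (α ((extChartAt I x).symm y)).comp
    (mfderivWithin 𝓘(ℝ, E) I (extChartAt I x).symm (Set.range I) y)

/-- The exterior derivative of a `1`-form at `x`, computed in the chart at `x`. No further pullback is
needed, since the tangent space at `x` is the model space, identified through the chart at `x`. -/
def extDerivAt (α : OneForm I M) (x : M) : TangentSpace I x [⋀^Fin 2]→L[ℝ] ℝ :=
  (extDerivWithin
    (fun y : E ↦ ContinuousAlternatingMap.ofSubsingleton ℝ E ℝ (0 : Fin 1) (localRep α x y))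
    (Set.range I) (extChartAt I x x) : E [⋀^Fin 2]→L[ℝ] ℝ)

theorem localRep_differentiable (α : OneForm I M) (x : M) :
    DifferentiableWithinAt ℝ (localRep α x) (Set.range I) (extChartAt I x x) := by
  have h2 := ((contMDiffAt_hom_bundle _).1 (α.contMDiff x)).2
  rw [contMDiffAt_iff] at h2
  have h3 := h2.2.differentiableWithinAt (by simp)
  have key : ∀ y ∈ (extChartAt I x).target, localRep α x y =
     (ContinuousLinearMap.inCoordinates E (TangentSpace I) ℝ (Bundle.Trivial M ℝ) x
      ((extChartAt I x).symm y) x ((extChartAt I x).symm y) (α ((extChartAt I x).symm y))) := by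
    intro y hy
    have hy' := (extChartAt I x).map_target hy
    rw [extChartAt_source] at hy'
    rw [ContinuousLinearMap.inCoordinates, TangentBundle.symmL_trivializationAt hy',
      (extChartAt I x).right_inv hy]
    ext v
    simp [localRep]
  refine h3.congr_of_eventuallyEq ?_ ?_
  · filter_upwards [extChartAt_target_mem_nhdsWithin x] with y hy using key y hy
  · exact key _ (mem_extChartAt_target x)

theorem ofSubsingleton_differentiable (α : OneForm I M) (x : M) :
    DifferentiableWithinAt ℝ (fun y : E ↦
      ContinuousAlternatingMap.ofSubsingleton ℝ E ℝ (0 : Fin 1) (localRep α x y))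
      (Set.range I) (extChartAt I x x) :=
  ((ContinuousAlternatingMap.ofSubsingletonLIE (𝕜 := ℝ) (E := E) (F := ℝ)
    (0 : Fin 1)).differentiable _).comp_differentiableWithinAt _ (localRep_differentiable α x)

theorem localRep_add (α β : OneForm I M) (x : M) (y : E) :
    localRep (α + β) x y = localRep α x y + localRep β x y := rfl

theorem localRep_smul (c : ℝ) (α : OneForm I M) (x : M) (y : E) :
    localRep (c • α) x y = c • localRep α x y := rfl

variable (I M) in
/-- The exterior derivative on `1`-forms. -/
def dOne : OneForm I M →ₗ[ℝ] (x : M) → TangentSpace I x [⋀^Fin 2]→L[ℝ] ℝ where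
  toFun α := extDerivAt α
  map_add' α β := by
    funext x
    exact extDerivWithin_add (I.uniqueDiffOn _ (by simp))
      (ofSubsingleton_differentiable α x) (ofSubsingleton_differentiable β x)
  map_smul' c α := by
    funext x
    exact extDerivWithin_smul (𝕜 := ℝ) (E := E) (F := ℝ) (n := 1) c
      (fun y ↦ ContinuousAlternatingMap.ofSubsingleton ℝ E ℝ (0 : Fin 1) (localRep α x y))
      (I.uniqueDiffOn (extChartAt I x x) (by simp))

theorem contMDiff_mfderiv (f : C^∞⟮I, M; ℝ⟯) :
    ContMDiff I (I.prod 𝓘(ℝ, E →L[ℝ] ℝ)) ∞ (fun x ↦ Bundle.TotalSpace.mk' (E →L[ℝ] ℝ)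
      (E := fun x : M ↦ TangentSpace I x →L[ℝ] Bundle.Trivial M ℝ x) x
        (mfderiv I 𝓘(ℝ, ℝ) f x)) := by
  intro x
  rw [contMDiffAt_hom_bundle]
  refine ⟨contMDiffAt_id, ?_⟩
  have := (f.contMDiff x).mfderiv_const (m := ∞) (by simp)
  convert this using 2 with y
  ext v
  simp [inTangentCoordinates, ContinuousLinearMap.inCoordinates]
  rfl

variable (I M) in
/-- The exterior derivative on smooth functions. -/
def dZero : C^∞⟮I, M; ℝ⟯ →ₗ[ℝ] OneForm I M where
  toFun f := ⟨fun x ↦ mfderiv I 𝓘(ℝ, ℝ) f x, contMDiff_mfderiv f⟩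
  map_add' f g := by
    ext x : 1
    exact mfderiv_add (f.contMDiff.mdifferentiable (by simp) x)
      (g.contMDiff.mdifferentiable (by simp) x)
  map_smul' c f := by
    ext x : 1
    exact const_smul_mfderiv (f.contMDiff.mdifferentiable (by simp) x) c

variable (I M) in
/-- The closed `1`-forms. -/
abbrev ClosedOneForm : Submodule ℝ (OneForm I M) := LinearMap.ker (dOne I M)

variable (I M) in
/-- The first de Rham cohomology: closed `1`-forms modulo the exact ones. -/
abbrev H1 : Type _ :=
  ClosedOneForm I M ⧸ (LinearMap.range (dZero I M)).submoduleOf (ClosedOneForm I M)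

/-- The cohomology class of a closed `1`-form. -/
def H1.mk : ClosedOneForm I M →ₗ[ℝ] H1 I M := Submodule.mkQ _

end DeRham

namespace Conf

section Pi
variable {ι : Type*} [Fintype ι] {E : Type*} [NormedAddCommGroup E] [NormedSpace ℝ E]
  {N : Type*} [TopologicalSpace N] [ChartedSpace E N]

/-- The model of the product of finitely many copies of a manifold modelled on `E`. -/
abbrev piModel (ι : Type*) [Fintype ι] (E : Type*) [NormedAddCommGroup E] [NormedSpace ℝ E] :
    ModelWithCorners ℝ (ι → E) (ModelPi fun _ : ι ↦ E) :=
  ModelWithCorners.pi fun _ : ι ↦ 𝓘(ℝ, E)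

instance : (piModel ι E).Boundaryless :=
  ⟨Set.eq_univ_of_forall fun y ↦ ⟨y, rfl⟩⟩

instance [IsManifold 𝓘(ℝ, E) ∞ N] : IsManifold (piModel ι E) ∞ (ι → N) := by
  apply isManifold_of_contDiffOn
  rintro _ _ ⟨e, he, rfl⟩ ⟨e', he', rfl⟩
  rw [contDiffOn_pi]
  intro i
  have h1 := (contDiffGroupoid ∞ 𝓘(ℝ, E)).compatible (he i trivial) (he' i trivial)
  rw [contDiffGroupoid, mem_groupoid_of_pregroupoid] at h1
  have h2 : ContDiffOn ℝ ∞ ((e i).symm ≫ₕ e' i) ((e i).symm ≫ₕ e' i).source := by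
    simpa [contDiffPregroupoid] using h1.1
  have h3 : ContDiff ℝ ∞ (fun y : ι → E ↦ y i) := contDiff_apply ℝ E i
  refine (h2.comp h3.contDiffOn ?_)
  rintro y ⟨⟨hy1, hy2⟩, -⟩
  exact ⟨hy1 i trivial, hy2 i trivial⟩

theorem contMDiff_eval [IsManifold 𝓘(ℝ, E) ∞ N] (i : ι) :
    ContMDiff (piModel ι E) 𝓘(ℝ, E) ∞ (fun x : ι → N ↦ x i) := by
  intro x
  rw [contMDiffAt_iff]
  refine ⟨(continuous_apply i).continuousAt, ?_⟩
  have h3 : ContDiff ℝ ∞ (fun y : ι → E ↦ y i) := contDiff_apply ℝ E i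
  refine h3.contDiffAt.contDiffWithinAt.congr_of_eventuallyEq ?_ ?_
  · filter_upwards [extChartAt_target_mem_nhdsWithin (I := piModel ι E) x] with y hy
    have : y i ∈ (extChartAt 𝓘(ℝ, E) (x i)).target := ⟨trivial, hy.2 i trivial⟩
    exact (extChartAt 𝓘(ℝ, E) (x i)).right_inv this
  · exact (extChartAt 𝓘(ℝ, E) (x i)).right_inv (mem_extChartAt_target (x i))

theorem contMDiff_pi_of {F G X : Type*} [NormedAddCommGroup F] [NormedSpace ℝ F]
    [TopologicalSpace G] {J : ModelWithCorners ℝ F G} [TopologicalSpace X] [ChartedSpace G X]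
    {f : X → ι → N}
    (h : ∀ i, ContMDiff J 𝓘(ℝ, E) ∞ (fun x ↦ f x i)) : ContMDiff J (piModel ι E) ∞ f := by
  intro x
  rw [contMDiffAt_iff]
  refine ⟨(continuous_pi fun i ↦ (h i).continuous).continuousAt, ?_⟩
  rw [contDiffWithinAt_pi]
  intro i
  exact (contMDiffAt_iff.1 (h i x)).2
end Pi

variable (m : ℕ) (N : Type*) [TopologicalSpace N] [T2Space N]

/-- The ordered `m`-tuples of pairwise distinct points of `N`, an open subset of `N ^ m`. -/
def ordConf : TopologicalSpace.Opens (Fin m → N) where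
  carrier := {x | Function.Injective x}
  is_open' := by
    have : {x : Fin m → N | Function.Injective x} =
        ⋂ i, ⋂ j, {x | i ≠ j → x i ≠ x j} := by
      ext x
      simp only [Set.mem_iInter, Set.mem_ofPred_eq]
      exact ⟨fun h i j hij he ↦ hij (h he), fun h i j he ↦ by_contra fun hij ↦ h i j hij he⟩
    rw [this]
    refine isOpen_iInter_of_finite fun i ↦ isOpen_iInter_of_finite fun j ↦ ?_
    by_cases hij : i = j
    · simp [hij]
    · simpa [hij] using isOpen_ne_fun (continuous_apply i) (continuous_apply j)

/-- The ordered configuration space, i.e. the embeddings of `m` points into `N`. -/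
abbrev OrdConf : Type _ := ordConf m N

variable {m N}

/-- The symmetric group permutes the labels. -/
instance : MulAction (Equiv.Perm (Fin m)) (OrdConf m N) where
  smul σ x := ⟨fun i ↦ x.1 (σ⁻¹ i), x.2.comp (σ⁻¹).injective⟩
  one_smul _ := rfl
  mul_smul _ _ _ := rfl

theorem smul_val (σ : Equiv.Perm (Fin m)) (x : OrdConf m N) (i : Fin m) :
    (σ • x).1 i = x.1 (σ⁻¹ i) := rfl

instance : ContinuousConstSMul (Equiv.Perm (Fin m)) (OrdConf m N) where
  continuous_const_smul σ := by
    have h : Continuous fun x : OrdConf m N ↦ (σ • x).1 :=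
      continuous_pi fun i ↦ (continuous_apply (σ⁻¹ i)).comp continuous_subtype_val
    exact continuous_induced_rng.2 h

instance : IsCancelSMul (Equiv.Perm (Fin m)) (OrdConf m N) where
  right_cancel' σ τ x h := by
    apply inv_injective
    ext i : 1
    exact x.2 (congrFun (congrArg Subtype.val h) i)

variable (m N) in
/-- The unordered `m`-point configuration space: the orbit space, with the quotient topology. -/
abbrev UConf : Type _ := MulAction.orbitRel.Quotient (Equiv.Perm (Fin m)) (OrdConf m N)

/-- The quotient map from ordered to unordered configurations. -/
def proj : OrdConf m N → UConf m N := Quotient.mk _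

variable {E : Type*} [NormedAddCommGroup E] [NormedSpace ℝ E] [ChartedSpace E N]

variable (E) in
theorem locallyCompactSpace_ordConf [FiniteDimensional ℝ E] (N : Type*) [TopologicalSpace N] [T2Space N]
    [ChartedSpace E N] : LocallyCompactSpace (OrdConf m N) :=
  haveI : LocallyCompactSpace N := Manifold.locallyCompact_of_finiteDimensional 𝓘(ℝ, E)
  (ordConf m N).isOpen.locallyCompactSpace

/-- The charts of the quotient manifold: local inverses of the quotient map followed by charts of
the ordered configuration space. -/
instance [FiniteDimensional ℝ E] : ChartedSpace (ModelPi fun _ : Fin m ↦ E) (UConf m N) :=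
  haveI := locallyCompactSpace_ordConf (m := m) E N
  MulAction.instChartedSpaceQuotient

theorem contMDiff_smul [IsManifold 𝓘(ℝ, E) ∞ N] (σ : Equiv.Perm (Fin m)) :
    ContMDiff (piModel (Fin m) E) (piModel (Fin m) E) ∞ (fun x : OrdConf m N ↦ σ • x) := by
  have h : ContMDiff (piModel (Fin m) E) (piModel (Fin m) E) ∞
      (fun x : OrdConf m N ↦ (σ • x).1) :=
    contMDiff_pi_of fun i ↦ (contMDiff_eval (σ⁻¹ i)).comp contMDiff_subtype_val
  exact (ContMDiff.subtypeVal_comp_iff (ordConf m N) fun x ↦ σ • x).mp h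

theorem isManifold_quotient {F G X Y K : Type*} [NormedAddCommGroup F] [NormedSpace ℝ F]
    [TopologicalSpace G] (J : ModelWithCorners ℝ F G) [TopologicalSpace X] [ChartedSpace G X]
    [IsManifold J ∞ X] [TopologicalSpace Y] [Group K] [MulAction K X]
    (hK : ∀ k : K, ContMDiff J J ∞ (fun x : X ↦ k • x)) {p : X → Y} (hp : IsLocalHomeomorph p)
    (hp' : Function.Surjective p) (hpK : ∀ x y, p x = p y ↔ x ∈ MulAction.orbit K y) :
    @IsManifold ℝ _ F _ _ G _ J ∞ Y _ (hp.chartedSpace hp') := by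
  let _ := hp.chartedSpace (H := G) hp'
  apply isManifold_of_contDiffOn
  rintro _ _ ⟨q, rfl⟩ ⟨q', rfl⟩
  generalize hp'.hasRightInverse.choose q = a
  generalize hp'.hasRightInverse.choose q' = a'
  rintro y ⟨⟨⟨hy1, hy2⟩, ⟨hy3, hy4⟩⟩, hy5⟩
  change J.symm y ∈ (chartAt G a).target at hy1
  change (hp.localInverseAt a).symm ((chartAt G a).symm (J.symm y)) ∈
    (hp.localInverseAt a').source at hy3
  change hp.localInverseAt a' ((hp.localInverseAt a).symm ((chartAt G a).symm (J.symm y))) ∈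
    (chartAt G a').source at hy4
  rw [hp.localInverseAt_symm] at hy3 hy4
  have hy1' : y ∈ (extChartAt J a).target := by
    rw [extChartAt_target]; exact ⟨hy1, hy5⟩
  have hcont : ContinuousWithinAt (extChartAt J a).symm (Set.range J) y :=
    (continuousAt_extChartAt_symm'' hy1').continuousWithinAt
  have hx0 : (extChartAt J a).symm y = (chartAt G a).symm (J.symm y) := by simp
  have hx0s : (extChartAt J a).symm y ∈ (chartAt G a).source := by
    simpa using (extChartAt J a).map_target hy1'
  have hyx : extChartAt J a ((extChartAt J a).symm y) = y := (extChartAt J a).right_inv hy1'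
  rw [← hx0] at hy3 hy4
  generalize hx : (extChartAt J a).symm y = x at *
  obtain ⟨k, hk⟩ := (hpK _ _).1 (hp.apply_localInverseAt_of_mem hy3)
  simp only at hk
  have hmain := ((contMDiffAt_iff_of_mem_source hx0s (hk ▸ hy4)).1 (hK k x)).2
  rw [hyx] at hmain
  refine (hmain.congr_of_eventuallyEq ?_ ?_).mono Set.inter_subset_right
  · have h1 := hcont.eventually_mem ((hp.localInverseAt a').open_source.preimage
      hp.continuous |>.mem_nhds (by rw [hx]; exact hy3))
    have h2 := hcont.eventually_mem ((hp.localInverseAt a').open_target.preimage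
      (hK k).continuous |>.mem_nhds (by
        rw [hx, Set.mem_preimage, hk]; exact (hp.localInverseAt a').map_source hy3))
    filter_upwards [h1, h2] with z hz1 hz2
    have : hp.localInverseAt a' (p ((extChartAt J a).symm z)) = k • (extChartAt J a).symm z := by
      refine hp.injOn_localInverseAt_target ((hp.localInverseAt a').map_source hz1) hz2 ?_
      rw [hp.apply_localInverseAt_of_mem hz1, eq_comm, hpK]
      exact ⟨k, rfl⟩
    simp only [Function.comp, ← this]
    simp
  · simp only [Function.comp, hx, hk]
    simp [← hx0]

instance [FiniteDimensional ℝ E] [IsManifold 𝓘(ℝ, E) ∞ N] : IsManifold (piModel (Fin m) E) ∞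
    (UConf m N) :=
  haveI := locallyCompactSpace_ordConf (m := m) E N
  isManifold_quotient _ contMDiff_smul
    isQuotientCoveringMap_quotientMk_of_properlyDiscontinuousSMul.isCoveringMap.isLocalHomeomorph
    Quotient.mk_surjective (fun _ _ ↦ Quotient.eq'')

/-- The form `∑ i, pr_i^* α` on the ordered configuration space: its value at `x` on a tangent vector
`v` is the sum over the `m` points (each of weight one) of `α` at `x i` on the `i`-th component
of `v`. -/
def hat [IsManifold 𝓘(ℝ, E) ∞ N] (α : DeRham.OneForm 𝓘(ℝ, E) N) (x : OrdConf m N) :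
    TangentSpace (piModel (Fin m) E) x →L[ℝ] ℝ :=
  ∑ i, (α (x.1 i)).comp
    (mfderiv (piModel (Fin m) E) 𝓘(ℝ, E) (fun z : OrdConf m N ↦ z.1 i) x)

/-- The pullback to the ordered configuration space of a form on the unordered one. -/
def pullProj [FiniteDimensional ℝ E] [IsManifold 𝓘(ℝ, E) ∞ N]
    (η : DeRham.OneForm (piModel (Fin m) E) (UConf m N)) (x : OrdConf m N) :
    TangentSpace (piModel (Fin m) E) x →L[ℝ] ℝ :=
  (η (proj x)).comp (mfderiv (piModel (Fin m) E) (piModel (Fin m) E) proj x)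

end Conf
end

/-! On a manifold without boundary a `1`-form is closed exactly when it is locally exact
(`isLocallyExact_of_dOne_eq_zero`, `dOne_eq_zero_of_isLocallyExact`), so the argument works with
local primitives throughout. Sums of local primitives of `α` at the `m` points are local primitives
of `hat α`. This form is invariant under permutations and `proj` is a local diffeomorphism, so it
descends to a locally exact, hence smooth and closed, form `descend α`. If `α = dh`, the symmetric
function `∑ i, h (x i)` descends as well, so there is an induced map on cohomology.

For injectivity, a primitive of `descend α` pulls back to a symmetric primitive `g` of `hat α`. Let
`f` be a primitive of `α` near `x`. Then `g - ∑ i, f (z i)` is locally constant on the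
configurations in a small chart ball. These need not form a connected space when the dimension is
one, but symmetry makes the difference constant anyway (`eq_of_eventually_eq_of_symmetric`), say
equal to `k`. So `g` tends to `m * f y + k` as the configuration collapses to a point `y` near `x`.
The limit does not depend on the choice of `x` and `f`, and divided by `m` it is a global primitive
of `α` (`exists_primitive_of_hat`). -/

noncomputable section
namespace DeRham

/-! ### Closed and locally exact `1`-forms -/

section LocallyExact
variable {E : Type*} [NormedAddCommGroup E] [NormedSpace ℝ E] {H : Type*} [TopologicalSpace H]
  {I : ModelWithCorners ℝ E H} {M : Type*} [TopologicalSpace M] [ChartedSpace H M]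

variable (I) in
/-- `f` is a smooth primitive of the covector field `α` on a neighbourhood of `x`. -/
def IsPrimitiveNear (f : M → ℝ) (α : ∀ x : M, TangentSpace I x →L[ℝ] ℝ) (x : M) : Prop :=
  ∀ᶠ y in 𝓝 x, ContMDiffAt I 𝓘(ℝ, ℝ) ∞ f y ∧ HasMFDerivAt I 𝓘(ℝ, ℝ) f y (α y)

variable (I) in
/-- A covector field that has a smooth primitive near every point. -/
def IsLocallyExact (α : ∀ x : M, TangentSpace I x →L[ℝ] ℝ) : Prop :=
  ∀ x, ∃ f : M → ℝ, IsPrimitiveNear I f α x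

variable [IsManifold I ∞ M]

/-- A differentiable function with vanishing differential near a point is constant near it. -/
theorem eventually_eq_of_hasMFDerivAt_zero [I.Boundaryless] {f : M → ℝ} {x : M}
    (h : ∀ᶠ y in 𝓝 x, HasMFDerivAt I 𝓘(ℝ, ℝ) f y (0 : TangentSpace I y →L[ℝ] ℝ)) :
    ∀ᶠ y in 𝓝 x, f y = f x := by
  have h1 : Filter.Tendsto (extChartAt I x).symm (𝓝 (extChartAt I x x)) (𝓝 x) := by
    simpa [ContinuousAt] using continuousAt_extChartAt_symm (I := I) x
  obtain ⟨r, hr, hball⟩ := Metric.eventually_nhds_iff_ball.1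
    ((h1.eventually h).and (extChartAt_target_mem_nhds (I := I) x))
  have h2 : ∀ y ∈ Metric.ball (extChartAt I x x) r,
      HasFDerivAt (f ∘ (extChartAt I x).symm) (0 : E →L[ℝ] ℝ) y := by
    intro y hy
    have h3 : ContMDiffAt 𝓘(ℝ, E) I ∞ (extChartAt I x).symm y :=
      (contMDiffOn_extChartAt_symm x).contMDiffAt (extChartAt_target_mem_nhds' (hball y hy).2)
    have h4 := (hball y hy).1.comp y (h3.mdifferentiableAt (by simp)).hasMFDerivAt
    have h5 : ((0 : E →L[ℝ] ℝ).comp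
        (mfderiv 𝓘(ℝ, E) I (extChartAt I x).symm y : E →L[ℝ] E)) = 0 :=
      ContinuousLinearMap.zero_comp _
    exact h5 ▸ h4.hasFDerivAt
  have h5 := (continuousAt_extChartAt (I := I) x).eventually (Metric.ball_mem_nhds _ hr)
  filter_upwards [h5, extChartAt_source_mem_nhds (I := I) x] with y hy hy'
  -- The chart ball is convex, hence connected, so a vanishing derivative forces a constant.
  have h6 := Metric.isOpen_ball.is_const_of_fderiv_eq_zero
    (convex_ball (extChartAt I x x) r).isPreconnected
    (fun y hy ↦ (h2 y hy).differentiableAt.differentiableWithinAt)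
    (fun y hy ↦ (h2 y hy).fderiv) hy (Metric.mem_ball_self hr)
  simpa only [Function.comp, (extChartAt I x).left_inv hy', extChartAt_to_inv] using h6

/-- Smoothness is local, and near each point the field is the differential of a smooth function. -/
theorem IsLocallyExact.contMDiff {α : ∀ x : M, TangentSpace I x →L[ℝ] ℝ}
    (h : IsLocallyExact I α) :
    ContMDiff I (I.prod 𝓘(ℝ, E →L[ℝ] ℝ)) ∞ (fun x ↦ Bundle.TotalSpace.mk' (E →L[ℝ] ℝ)
      (E := fun x : M ↦ TangentSpace I x →L[ℝ] Bundle.Trivial M ℝ x) x (α x)) := by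
  intro x
  obtain ⟨f, hf⟩ := h x
  rw [contMDiffAt_hom_bundle]
  refine ⟨contMDiffAt_id, ?_⟩
  have := (hf.self_of_nhds.1).mfderiv_const (m := ∞) (by simp)
  refine this.congr_of_eventuallyEq ?_
  filter_upwards [hf] with y hy
  have h3 : α y = mfderiv I 𝓘(ℝ, ℝ) f y := hy.2.mfderiv.symm
  rw [h3]
  ext v
  simp [inTangentCoordinates, ContinuousLinearMap.inCoordinates]
  rfl

theorem eventually_localRep_eq_fderiv [I.Boundaryless] (α : OneForm I M) {f : M → ℝ} {x : M}
    (hf : IsPrimitiveNear I f α x) :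
    ∀ᶠ y in 𝓝 (extChartAt I x x), ContDiffAt ℝ ∞ (f ∘ (extChartAt I x).symm) y ∧
      localRep α x y = fderiv ℝ (f ∘ (extChartAt I x).symm) y := by
  have h1 : Filter.Tendsto (extChartAt I x).symm (𝓝 (extChartAt I x x)) (𝓝 x) := by
    simpa [ContinuousAt] using continuousAt_extChartAt_symm (I := I) x
  have h2 := h1.eventually hf
  filter_upwards [h2, extChartAt_target_mem_nhds (I := I) x] with y hy hy'
  have h3 : ContMDiffAt 𝓘(ℝ, E) I ∞ (extChartAt I x).symm y :=
    (contMDiffOn_extChartAt_symm x).contMDiffAt (extChartAt_target_mem_nhds' hy')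
  refine ⟨(hy.1.comp y h3).contDiffAt, ?_⟩
  have h4 := hy.2.comp y (h3.mdifferentiableAt (by simp)).hasMFDerivAt
  have h5 : HasFDerivAt (f ∘ (extChartAt I x).symm) (localRep α x y) y := by
    rw [localRep, I.range_eq_univ, mfderivWithin_univ]
    exact h4.hasFDerivAt
  exact h5.fderiv.symm

/-- In the chart at `x` the form is `dg` near the centre, so this is `d ∘ d = 0`. -/
theorem dOne_eq_zero_of_isLocallyExact [I.Boundaryless] (α : OneForm I M)
    (h : IsLocallyExact I α) : dOne I M α = 0 := by
  funext x
  obtain ⟨f, hf⟩ := h x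
  have h1 := eventually_localRep_eq_fderiv α hf
  set g := f ∘ (extChartAt I x).symm
  change extDerivWithin _ _ _ = _
  rw [I.range_eq_univ, extDerivWithin_univ]
  have h2 : (fun y : E ↦ ContinuousAlternatingMap.ofSubsingleton ℝ E ℝ (0 : Fin 1)
      (localRep α x y)) =ᶠ[𝓝 (extChartAt I x x)]
      extDeriv (fun y ↦ ContinuousAlternatingMap.constOfIsEmpty ℝ E (Fin 0) (g y)) := by
    filter_upwards [h1] with y hy
    rw [extDeriv_constOfIsEmpty, hy.2]
  rw [h2.extDeriv_eq]
  refine extDeriv_extDeriv_apply (r := ∞) ?_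
    (by simpa using WithTop.coe_le_coe.2 (le_top : (2 : ℕ∞) ≤ ⊤))
  exact (ContinuousAlternatingMap.constOfIsEmptyLIE ℝ E ℝ (Fin 0)).contDiff.contDiffAt.comp _
    h1.self_of_nhds.1

theorem contDiffAt_localRep_center [I.Boundaryless] (α : OneForm I M) (x : M) :
    ContDiffAt ℝ ∞ (localRep α x) (extChartAt I x x) := by
  have h2 := ((contMDiffAt_hom_bundle _).1 (α.contMDiff x)).2
  rw [contMDiffAt_iff] at h2
  have h3 := h2.2
  rw [I.range_eq_univ, contDiffWithinAt_univ] at h3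
  refine h3.congr_of_eventuallyEq ?_
  filter_upwards [extChartAt_target_mem_nhds (I := I) x] with y hy
  have hy' := (extChartAt I x).map_target hy
  rw [extChartAt_source] at hy'
  simp only [Function.comp, extChartAt_model_space_eq_id, PartialEquiv.refl_coe, id]
  rw [ContinuousLinearMap.inCoordinates, TangentBundle.symmL_trivializationAt hy',
    (extChartAt I x).right_inv hy]
  ext v
  simp [localRep]

/-- `dOne` sees each point only in the chart centred there. To use closedness at a non-central point
of one fixed chart, the representative is transported along the transition map to the chart of that
point. -/
theorem localRep_eventuallyEq_pullback [I.Boundaryless] (α : OneForm I M) (x : M) {y : E}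
    (hy : y ∈ (extChartAt I x).target) :
    ∀ᶠ z in 𝓝 y, localRep α x z =
      (localRep α ((extChartAt I x).symm y)
        ((extChartAt I ((extChartAt I x).symm y) ∘ (extChartAt I x).symm) z)).comp
      (fderiv ℝ (extChartAt I ((extChartAt I x).symm y) ∘ (extChartAt I x).symm) z) := by
  set x' := (extChartAt I x).symm y
  have hc : ContinuousAt (extChartAt I x).symm y := continuousAt_extChartAt_symm'' hy
  have h1 := hc.eventually (eventually_mem_nhds_iff.2 (extChartAt_source_mem_nhds (I := I) x'))
  filter_upwards [h1, (isOpen_extChartAt_target (I := I) x).mem_nhds hy] with z hz hz'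
  have hs : ContMDiffAt 𝓘(ℝ, E) I ∞ (extChartAt I x).symm z :=
    (contMDiffOn_extChartAt_symm x).contMDiffAt (extChartAt_target_mem_nhds' hz')
  have hzs : (extChartAt I x).symm z ∈ (extChartAt I x').source := mem_of_mem_nhds hz
  have he : ContMDiffAt I 𝓘(ℝ, E) ∞ (extChartAt I x') ((extChartAt I x).symm z) :=
    contMDiffAt_extChartAt' (by simpa using hzs)
  have hs' : ContMDiffAt 𝓘(ℝ, E) I ∞ (extChartAt I x').symm
      (extChartAt I x' ((extChartAt I x).symm z)) :=
    (contMDiffOn_extChartAt_symm x').contMDiffAt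
      (extChartAt_target_mem_nhds' ((extChartAt I x').map_source hzs))
  have hcomp := ((he.comp z hs).mdifferentiableAt (by simp)).hasMFDerivAt
  have h2 := (hs'.mdifferentiableAt (by simp)).hasMFDerivAt.comp z hcomp
  have hcz : ContinuousAt (extChartAt I x).symm z := hs.continuousAt
  have h3 : (extChartAt I x').symm ∘ (extChartAt I x' ∘ (extChartAt I x).symm) =ᶠ[𝓝 z]
      (extChartAt I x).symm := by
    filter_upwards [hcz.eventually hz] with w hw
    exact (extChartAt I x').left_inv hw
  have h4 : mfderiv 𝓘(ℝ, E) I (extChartAt I x).symm z = _ :=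
    (h2.congr_of_eventuallyEq h3.symm).mfderiv
  simp only [localRep, I.range_eq_univ, mfderivWithin_univ]
  rw [h4, mfderiv_eq_fderiv]
  ext v
  simp only [Function.comp_apply, ContinuousLinearMap.comp_apply]
  rw [(extChartAt I x').left_inv hzs]
  rfl

theorem contDiffAt_extChartAt_comp_symm [I.Boundaryless] (x : M) {y : E}
    (hy : y ∈ (extChartAt I x).target) :
    ContDiffAt ℝ ∞ (extChartAt I ((extChartAt I x).symm y) ∘ (extChartAt I x).symm) y :=
  (contMDiffAt_extChartAt.comp y ((contMDiffOn_extChartAt_symm x).contMDiffAt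
    (extChartAt_target_mem_nhds' hy))).contDiffAt

theorem contDiffAt_localRep [I.Boundaryless] (α : OneForm I M) (x : M) {y : E}
    (hy : y ∈ (extChartAt I x).target) : ContDiffAt ℝ ∞ (localRep α x) y := by
  have hτ := contDiffAt_extChartAt_comp_symm (I := I) x hy
  refine ContDiffAt.congr_of_eventuallyEq ?_ (localRep_eventuallyEq_pullback α x hy)
  exact ((contDiffAt_localRep_center α _).comp y hτ).clm_comp (hτ.fderiv_right (by simp))

/-- The exterior derivative commutes with pullback along the transition map, and closedness makes it
vanish at the centre of the other chart. -/
theorem extDeriv_localRep [I.Boundaryless] {α : OneForm I M} (hα : dOne I M α = 0) (x : M) {y : E}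
    (hy : y ∈ (extChartAt I x).target) :
    extDeriv (fun z : E ↦ ContinuousAlternatingMap.ofSubsingleton ℝ E ℝ (0 : Fin 1)
      (localRep α x z)) y = 0 := by
  have hτ := contDiffAt_extChartAt_comp_symm (I := I) x hy
  have h1 : extDeriv (fun z : E ↦ ContinuousAlternatingMap.ofSubsingleton ℝ E ℝ (0 : Fin 1)
      (localRep α ((extChartAt I x).symm y) z))
      (extChartAt I ((extChartAt I x).symm y) ((extChartAt I x).symm y)) = 0 := by
    have h := congrFun hα ((extChartAt I x).symm y)
    rw [← extDerivWithin_univ, ← I.range_eq_univ]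
    exact h
  have hd := ofSubsingleton_differentiable α ((extChartAt I x).symm y)
  rw [I.range_eq_univ, differentiableWithinAt_univ] at hd
  have h2 := extDeriv_pullback (x := y)
    (f := extChartAt I ((extChartAt I x).symm y) ∘ (extChartAt I x).symm) hd hτ
    (by simpa using WithTop.coe_le_coe.2 (le_top : (2 : ℕ∞) ≤ ⊤))
  rw [Function.comp_apply, h1] at h2
  have h3 : (fun z : E ↦ ContinuousAlternatingMap.ofSubsingleton ℝ E ℝ (0 : Fin 1)
      (localRep α x z)) =ᶠ[𝓝 y] _ :=
    (localRep_eventuallyEq_pullback α x hy).mono fun z hz ↦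
      congrArg (ContinuousAlternatingMap.ofSubsingleton ℝ E ℝ (0 : Fin 1)) hz
  rw [h3.extDeriv_eq]
  refine Eq.trans ?_ (h2.trans ?_)
  · congr 1
  · ext v
    simp

/-- The exterior derivative evaluated on `![u, v]` is the antisymmetrised derivative. The symmetry
is the integrability condition in the convex Poincaré lemma. -/
theorem fderiv_localRep_symm [I.Boundaryless] {α : OneForm I M} (hα : dOne I M α = 0) (x : M)
    {y : E} (hy : y ∈ (extChartAt I x).target) (u v : E) :
    fderiv ℝ (localRep α x) y u v = fderiv ℝ (localRep α x) y v u := by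
  have hd : HasFDerivAt (localRep α x) _ y :=
    ((contDiffAt_localRep α x hy).differentiableAt (by simp)).hasFDerivAt
  have hd' := (ContinuousAlternatingMap.ofSubsingletonLIE (𝕜 := ℝ) (E := E) (F := ℝ)
    (0 : Fin 1)).hasFDerivAt.comp y hd
  have h1 : extDeriv (ContinuousAlternatingMap.ofSubsingletonLIE (𝕜 := ℝ) (E := E) (F := ℝ)
      (0 : Fin 1) ∘ localRep α x) y ![u, v] = 0 :=
    congrArg (fun β : E [⋀^Fin 2]→L[ℝ] ℝ ↦ β ![u, v]) (extDeriv_localRep hα x hy)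
  rw [extDeriv, hd'.fderiv, ContinuousAlternatingMap.alternatizeUncurryFin_apply] at h1
  simp [Fin.sum_univ_two, Fin.removeNth] at h1
  linarith

/-- The Poincaré lemma: a closed `1`-form is locally exact. -/
theorem isLocallyExact_of_dOne_eq_zero [I.Boundaryless] {α : OneForm I M} (hα : dOne I M α = 0) :
    IsLocallyExact I α := by
  intro x
  obtain ⟨r, hr, hball⟩ := Metric.mem_nhds_iff.1 (extChartAt_target_mem_nhds (I := I) x)
  have hsm : ContDiffOn ℝ ∞ (localRep α x) (Metric.ball (extChartAt I x x) r) := fun y hy ↦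
    (contDiffAt_localRep α x (hball hy)).contDiffWithinAt
  obtain ⟨g, hg⟩ := (convex_ball (extChartAt I x x) r).exists_forall_hasFDerivAt_of_fderiv_symmetric
    Metric.isOpen_ball (hsm.differentiableOn (by simp))
    (fun y hy ↦ fderiv_localRep_symm hα x (hball hy))
  have hgsm : ContDiffOn ℝ ∞ g (Metric.ball (extChartAt I x x) r) := by
    rw [contDiffOn_infty_iff_fderiv_of_isOpen Metric.isOpen_ball]
    exact ⟨fun y hy ↦ (hg y hy).differentiableAt.differentiableWithinAt,
      hsm.congr fun y hy ↦ (hg y hy).fderiv⟩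
  refine ⟨g ∘ extChartAt I x, ?_⟩
  have h5 := (continuousAt_extChartAt (I := I) x).eventually (Metric.ball_mem_nhds _ hr)
  filter_upwards [h5, eventually_mem_nhds_iff.2 (extChartAt_source_mem_nhds (I := I) x)]
    with y hy hy'
  have hys := mem_of_mem_nhds hy'
  have he : ContMDiffAt I 𝓘(ℝ, E) ∞ (extChartAt I x) y :=
    contMDiffAt_extChartAt' (by simpa using hys)
  have hs : ContMDiffAt 𝓘(ℝ, E) I ∞ (extChartAt I x).symm (extChartAt I x y) :=
    (contMDiffOn_extChartAt_symm x).contMDiffAt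
      (extChartAt_target_mem_nhds' ((extChartAt I x).map_source hys))
  refine ⟨((hgsm.contDiffAt (Metric.isOpen_ball.mem_nhds hy)).contMDiffAt).comp y he, ?_⟩
  have hed := (he.mdifferentiableAt (by simp)).hasMFDerivAt
  have h1 := (hg _ hy).hasMFDerivAt.comp y hed
  -- The derivatives of the chart and of its inverse cancel, so pulling `localRep` back along the
  -- chart recovers `α`.
  have h2 := ((hs.mdifferentiableAt (by simp)).hasMFDerivAt.comp y hed).congr_of_eventuallyEq
    (f₁ := id) (by
      filter_upwards [hy'] with z hz
      exact ((extChartAt I x).left_inv hz).symm)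
  have h3 := hasMFDerivAt_unique h2 (hasMFDerivAt_id y)
  have h4 : ∀ v : E, localRep α x (extChartAt I x y)
      ((mfderiv I 𝓘(ℝ, E) (extChartAt I x) y : E →L[ℝ] E) v) = (α y : E →L[ℝ] ℝ) v := by
    intro v
    have h5 : (mfderiv 𝓘(ℝ, E) I (extChartAt I x).symm (extChartAt I x y) : E →L[ℝ] E)
      ((mfderiv I 𝓘(ℝ, E) (extChartAt I x) y : E →L[ℝ] E) v) = v := congrArg (fun L ↦ L v) h3
    rw [localRep, I.range_eq_univ, mfderivWithin_univ, (extChartAt I x).left_inv hys]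
    exact congrArg (α y : E →L[ℝ] ℝ) h5
  have h6 : (localRep α x (extChartAt I x y)).comp
      (mfderiv I 𝓘(ℝ, E) (extChartAt I x) y : E →L[ℝ] E) = (α y : E →L[ℝ] ℝ) :=
    ContinuousLinearMap.ext h4
  exact h6 ▸ h1

end LocallyExact
end DeRham

/-! ### The orbit map as a local diffeomorphism -/

section Quotient
variable {F G X Y K : Type*} [NormedAddCommGroup F] [NormedSpace ℝ F] [TopologicalSpace G]
  {J : ModelWithCorners ℝ F G} [TopologicalSpace X] [ChartedSpace G X] [IsManifold J ∞ X]
  [TopologicalSpace Y]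

/-- A surjective local homeomorphism whose fibres are the orbits of a group of diffeomorphisms is a
local diffeomorphism for the charts pushed forward along it. -/
theorem IsLocalHomeomorph.isLocalDiffeomorph_chartedSpace [Group K] [MulAction K X]
    (hK : ∀ k : K, ContMDiff J J ∞ (fun x : X ↦ k • x)) {p : X → Y} (hp : IsLocalHomeomorph p)
    (hp' : Function.Surjective p) (hpK : ∀ x y, p x = p y ↔ x ∈ MulAction.orbit K y) :
    @IsLocalDiffeomorph ℝ _ F _ _ F _ _ G _ G _ J J X _ _ Y _ (hp.chartedSpace hp') ∞ p := by
  let _ := hp.chartedSpace (H := G) hp'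
  have := Conf.isManifold_quotient J hK hp hp' hpK
  intro x
  -- The chart at `p x` is built from this chosen preimage: it is the local inverse of `p` at `a`
  -- followed by the chart at `a`. Hence `p` reads as the identity in charts near `a`, and a group
  -- element carries `x` to `a`.
  let a := hp'.hasRightInverse.choose (p x)
  have ha : p a = p x := hp'.hasRightInverse.choose_spec (p x)
  have h1 : IsLocalDiffeomorphAt J J ∞ p a := by
    let e := (chartAt G a).trans (chartAt G (p x)).symm
    have hsrc : e.source ⊆ (hp.localInverseAt a).target := by
      rintro z ⟨hz, hz'⟩
      have hz2 : chartAt G a z ∈ ((hp.localInverseAt a).trans (chartAt G a)).target := hz'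
      rw [OpenPartialHomeomorph.trans_target] at hz2
      simpa [(chartAt G a).left_inv hz] using hz2.2
    refine ⟨⟨e.toPartialEquiv, e.open_source, e.open_target, ?_, ?_⟩, ?_, ?_⟩
    · exact (contMDiffOn_chart_symm (x := p x)).comp (contMDiffOn_chart.mono fun z hz ↦ hz.1)
        fun z hz ↦ hz.2
    · exact (contMDiffOn_chart_symm (x := a)).comp (contMDiffOn_chart.mono fun z hz ↦ hz.1)
        fun z hz ↦ hz.2
    · refine ⟨mem_chart_source G a, ?_⟩
      change chartAt G a a ∈ ((hp.localInverseAt a).trans (chartAt G a)).target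
      rw [OpenPartialHomeomorph.trans_target]
      simp
    · intro z hz
      change p z = ((hp.localInverseAt a).trans (chartAt G a)).symm (chartAt G a z)
      simp [(chartAt G a).left_inv hz.1]
  obtain ⟨k, hk⟩ := (hpK a x).1 ha
  let D : Diffeomorph J J X X ∞ :=
    { toFun := fun z ↦ k • z
      invFun := fun z ↦ k⁻¹ • z
      left_inv := fun z ↦ inv_smul_smul k z
      right_inv := fun z ↦ smul_inv_smul k z
      contMDiff_toFun := hK k
      contMDiff_invFun := hK k⁻¹ }
  have h2 : IsLocalDiffeomorphAt J J ∞ p (D x) := by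
    have : D x = a := hk
    rwa [this]
  have h3 := (D.isLocalDiffeomorph x).comp J Y h2
  have h4 : p ∘ D = p := by
    funext z
    exact (hpK _ _).2 ⟨k, rfl⟩
  rwa [h4] at h3

end Quotient

namespace DeRham
-- Descent along a surjective local diffeomorphism
section Descent
variable {E E' H H' M M' : Type*} [NormedAddCommGroup E] [NormedSpace ℝ E] [TopologicalSpace H]
  [NormedAddCommGroup E'] [NormedSpace ℝ E'] [TopologicalSpace H']
  {I : ModelWithCorners ℝ E H} {I' : ModelWithCorners ℝ E' H'}
  [TopologicalSpace M] [ChartedSpace H M] [TopologicalSpace M'] [ChartedSpace H' M']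

/-- Smoothness descends along a surjective local diffeomorphism. -/
theorem contMDiff_of_comp_isLocalDiffeomorph {p : M → M'} (hp : IsLocalDiffeomorph I I' ∞ p)
    (hp' : Function.Surjective p) {f : M' → ℝ} (hf : ContMDiff I 𝓘(ℝ, ℝ) ∞ (f ∘ p)) :
    ContMDiff I' 𝓘(ℝ, ℝ) ∞ f := by
  intro q
  obtain ⟨x, rfl⟩ := hp' q
  have h1 := (hf.contMDiffAt (x := (hp x).localInverse (p x))).comp (p x)
    (hp x).localInverse_contMDiffAt
  refine h1.congr_of_eventuallyEq ?_
  filter_upwards [(hp x).localInverse_eventuallyEq_right] with z hz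
  exact congrArg f hz.symm

/-- Local exactness descends along a surjective local diffeomorphism. -/
theorem IsLocallyExact.of_comp_isLocalDiffeomorph {p : M → M'} (hp : IsLocalDiffeomorph I I' ∞ p)
    (hp' : Function.Surjective p) {β : ∀ q : M', TangentSpace I' q →L[ℝ] ℝ}
    {α : ∀ x : M, TangentSpace I x →L[ℝ] ℝ} (hα : IsLocallyExact I α)
    (h : ∀ x, (β (p x)).comp (mfderiv I I' p x) = α x) : IsLocallyExact I' β := by
  intro q
  obtain ⟨x, rfl⟩ := hp' q
  obtain ⟨f, hf⟩ := hα x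
  have hinv := (hp x).localInverse_left_inv (hp x).localInverse_mem_target
  have hc : Filter.Tendsto (hp x).localInverse (𝓝 (p x)) (𝓝 x) := by
    have := (hp x).localInverse_contMDiffAt.continuousAt
    rwa [ContinuousAt, hinv] at this
  refine ⟨f ∘ (hp x).localInverse, ?_⟩
  filter_upwards [hc.eventually hf,
    (hp x).localInverse_open_source.mem_nhds (hp x).localInverse_mem_source] with y hy hy'
  have hs : ContMDiffAt I' I ∞ (hp x).localInverse y :=
    (hp x).contmdiffOn_localInverse.contMDiffAt ((hp x).localInverse_open_source.mem_nhds hy')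
  refine ⟨hy.1.comp y hs, ?_⟩
  have hsd := (hs.mdifferentiableAt (by simp)).hasMFDerivAt
  have h1 := hy.2.comp y hsd
  set z := (hp x).localInverse y with hz
  have hpz : p z = y := (hp x).localInverse_right_inv hy'
  have hpd := ((hp z).mdifferentiableAt (by simp)).hasMFDerivAt
  have h2 := (hpd.comp y hsd).congr_of_eventuallyEq (f₁ := id) (by
      filter_upwards [(hp x).localInverse_open_source.mem_nhds hy'] with w hw
      exact ((hp x).localInverse_right_inv hw).symm)
  have h3 := hasMFDerivAt_unique h2 (hasMFDerivAt_id y)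
  have h4 : (α z : E →L[ℝ] ℝ).comp (mfderiv I' I (hp x).localInverse y : E' →L[ℝ] E) =
      (β y : E' →L[ℝ] ℝ) := by
    ext v
    have h5 : (mfderiv I I' p z : E →L[ℝ] E')
      ((mfderiv I' I (hp x).localInverse y : E' →L[ℝ] E) v) = v := congrArg (fun L ↦ L v) h3
    have h6 : (α z : E →L[ℝ] ℝ) = (β y : E' →L[ℝ] ℝ).comp (mfderiv I I' p z : E →L[ℝ] E') := by
      rw [← h z, hpz]
    rw [h6]
    exact congrArg (β y : E' →L[ℝ] ℝ) h5
  exact h4 ▸ h1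

end Descent
end DeRham

/-! ### Invariance of `hat α` and its descent to the quotient -/

namespace Conf
variable {m : ℕ} {N : Type*} [TopologicalSpace N] [T2Space N]
  {E : Type*} [NormedAddCommGroup E] [NormedSpace ℝ E] [ChartedSpace E N]
  [IsManifold 𝓘(ℝ, E) ∞ N]

theorem isLocalDiffeomorph_proj [FiniteDimensional ℝ E] :
    IsLocalDiffeomorph (piModel (Fin m) E) (piModel (Fin m) E) ∞
      (proj : OrdConf m N → UConf m N) :=
  haveI := locallyCompactSpace_ordConf (m := m) E N
  IsLocalHomeomorph.isLocalDiffeomorph_chartedSpace contMDiff_smul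
    isQuotientCoveringMap_quotientMk_of_properlyDiscontinuousSMul.isCoveringMap.isLocalHomeomorph
    Quotient.mk_surjective (fun _ _ ↦ Quotient.eq'')

theorem proj_surjective : Function.Surjective (proj : OrdConf m N → UConf m N) :=
  Quotient.mk_surjective

theorem proj_eq_iff {x y : OrdConf m N} :
    proj x = proj y ↔ ∃ σ : Equiv.Perm (Fin m), σ • y = x :=
  Quotient.eq''

theorem contMDiff_coord (i : Fin m) :
    ContMDiff (piModel (Fin m) E) 𝓘(ℝ, E) ∞ (fun z : OrdConf m N ↦ z.1 i) :=
  (contMDiff_eval i).comp contMDiff_subtype_val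

theorem hasMFDerivAt_sum_coord {α : DeRham.OneForm 𝓘(ℝ, E) N} {x : OrdConf m N}
    {f : Fin m → N → ℝ} (hf : ∀ i, HasMFDerivAt 𝓘(ℝ, E) 𝓘(ℝ, ℝ) (f i) (x.1 i) (α (x.1 i))) :
    HasMFDerivAt (piModel (Fin m) E) 𝓘(ℝ, ℝ) (fun z : OrdConf m N ↦ ∑ i, f i (z.1 i)) x
      (hat α x) := by
  have h := HasMFDerivAt.sum (t := Finset.univ) (f := fun i (z : OrdConf m N) ↦ f i (z.1 i))
    (fun i _ ↦ (hf i).comp x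
      ((contMDiff_coord (E := E) i x).mdifferentiableAt (by simp)).hasMFDerivAt)
  have h2 : (∑ i, fun z : OrdConf m N ↦ f i (z.1 i)) = fun z ↦ ∑ i, f i (z.1 i) := by
    ext z
    simp
  rw [h2] at h
  exact h

/-- Add up local primitives of `α` chosen separately at each of the `m` points. -/
theorem isLocallyExact_hat {α : DeRham.OneForm 𝓘(ℝ, E) N}
    (hα : DeRham.IsLocallyExact 𝓘(ℝ, E) α) :
    DeRham.IsLocallyExact (piModel (Fin m) E) (fun x : OrdConf m N ↦ hat α x) := by
  intro x
  choose f hf using fun i ↦ hα (x.1 i)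
  refine ⟨fun z ↦ ∑ i, f i (z.1 i), ?_⟩
  have h : ∀ᶠ z in 𝓝 x, ∀ i, ContMDiffAt 𝓘(ℝ, E) 𝓘(ℝ, ℝ) ∞ (f i) (z.1 i) ∧
      HasMFDerivAt 𝓘(ℝ, E) 𝓘(ℝ, ℝ) (f i) (z.1 i) (α (z.1 i)) :=
    Filter.eventually_all.2 fun i ↦
      (contMDiff_coord (E := E) i).continuous.continuousAt.eventually (hf i)
  filter_upwards [h] with z hz
  refine ⟨?_, hasMFDerivAt_sum_coord fun i ↦ (hz i).2⟩
  exact contMDiffAt_finsetSum fun i _ ↦ (hz i).1.comp z (contMDiff_coord i z)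

/-- By the chain rule, acting by `σ` only reindexes the sum. -/
theorem hat_smul (α : DeRham.OneForm 𝓘(ℝ, E) N) (σ : Equiv.Perm (Fin m)) (x : OrdConf m N) :
    (hat α (σ • x)).comp (mfderiv (piModel (Fin m) E) (piModel (Fin m) E)
      (fun z : OrdConf m N ↦ σ • z) x) = hat α x := by
  have h : ∀ i, mfderiv (piModel (Fin m) E) 𝓘(ℝ, E) (fun z : OrdConf m N ↦ z.1 (σ⁻¹ i)) x =
      (mfderiv (piModel (Fin m) E) 𝓘(ℝ, E) (fun z : OrdConf m N ↦ z.1 i) (σ • x)).comp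
        (mfderiv (piModel (Fin m) E) (piModel (Fin m) E) (fun z : OrdConf m N ↦ σ • z) x) :=
    fun i ↦ mfderiv_comp x ((contMDiff_coord i (σ • x)).mdifferentiableAt (by simp))
      ((contMDiff_smul σ x).mdifferentiableAt (by simp))
  let G : Fin m → (TangentSpace (piModel (Fin m) E) x →L[ℝ] ℝ) := fun i ↦ (α (x.1 i)).comp
    (mfderiv (piModel (Fin m) E) 𝓘(ℝ, E) (fun z : OrdConf m N ↦ z.1 i) x)
  have h2 : hat α x = ∑ i, (α (x.1 (σ⁻¹ i))).comp
      (mfderiv (piModel (Fin m) E) 𝓘(ℝ, E) (fun z : OrdConf m N ↦ z.1 (σ⁻¹ i)) x) :=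
    (Equiv.sum_comp σ⁻¹ G).symm
  rw [h2, hat, ContinuousLinearMap.finsetSum_comp]
  refine Finset.sum_congr rfl fun i _ ↦ ?_
  rw [h i]
  rfl

theorem mfderiv_proj_smul [FiniteDimensional ℝ E] (σ : Equiv.Perm (Fin m)) (x : OrdConf m N) :
    (mfderiv (piModel (Fin m) E) (piModel (Fin m) E) proj (σ • x)).comp
      (mfderiv (piModel (Fin m) E) (piModel (Fin m) E) (fun z : OrdConf m N ↦ σ • z) x) =
    mfderiv (piModel (Fin m) E) (piModel (Fin m) E) proj x := by
  have h := mfderiv_comp x ((isLocalDiffeomorph_proj (E := E) (σ • x)).mdifferentiableAt (by simp))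
      ((contMDiff_smul σ x).mdifferentiableAt (by simp))
  rw [← h]
  congr 1
  funext z
  exact proj_eq_iff.2 ⟨σ, rfl⟩

/-- The covector field on the unordered configuration space whose pullback is `hat α`. -/
def descend [FiniteDimensional ℝ E] (α : DeRham.OneForm 𝓘(ℝ, E) N) (q : UConf m N) :
    TangentSpace (piModel (Fin m) E) q →L[ℝ] ℝ :=
  (hat α (Function.surjInv proj_surjective q)).comp
    ((isLocalDiffeomorph_proj (E := E) (Function.surjInv proj_surjective q)
      ).mfderivToContinuousLinearEquiv (by simp)).symm.toContinuousLinearMap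

/-- `descend` uses one chosen lift of each configuration. Any other lift differs from it by a
permutation, under which both `hat α` and the derivative of `proj` are equivariant. -/
theorem descend_comp_mfderiv_proj [FiniteDimensional ℝ E] (α : DeRham.OneForm 𝓘(ℝ, E) N)
    (x : OrdConf m N) :
    (descend α (proj x)).comp (mfderiv (piModel (Fin m) E) (piModel (Fin m) E) proj x) =
      hat α x := by
  have key : ∀ q : UConf m N, (descend α q).comp (mfderiv (piModel (Fin m) E) (piModel (Fin m) E)
      proj (Function.surjInv (proj_surjective (m := m) (N := N)) q)) =
      hat α (Function.surjInv proj_surjective q) := by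
    intro q
    ext v
    exact congrArg (hat α (Function.surjInv proj_surjective q))
      (((isLocalDiffeomorph_proj (E := E) (Function.surjInv proj_surjective q)
      ).mfderivToContinuousLinearEquiv (by simp)).symm_apply_apply v)
  obtain ⟨σ, hσ⟩ := proj_eq_iff.1 (Function.surjInv_eq proj_surjective (proj x))
  have h := key (proj x)
  rw [← hσ] at h
  rw [← hat_smul α σ x, ← mfderiv_proj_smul σ x, ← h]
  rfl

end Conf

/-! ### Symmetric primitives near the diagonal -/

namespace Conf

section Chart
variable {m : ℕ} {N E : Type*} [TopologicalSpace N] [NormedAddCommGroup E] [NormedSpace ℝ E]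

/-- Tuples that a linear functional separates in a chart are dense among all tuples in the domain
of the chart. -/
theorem frequently_injective_chart (c : OpenPartialHomeomorph N E) {ℓ : E →L[ℝ] ℝ} {v : E}
    (hv : ℓ v = 1) {a : Fin m → N} (ha : ∀ i, a i ∈ c.source) :
    ∃ᶠ w in 𝓝 a, (∀ i, w i ∈ c.source) ∧ Function.Injective fun i ↦ ℓ (c (w i)) := by
  -- The `i`-th point moves with speed `i` along `v`. As `ℓ v = 1`, two of the `ℓ`-values coincide
  -- for only one `t`, so all are distinct for small `t ≠ 0`.
  let y : ℝ → Fin m → E := fun t i ↦ c (a i) + (t * (i : ℝ)) • v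
  have hy : ∀ i, Filter.Tendsto (fun t ↦ y t i) (𝓝[≠] 0) (𝓝 (c (a i))) := by
    intro i
    have h : Continuous fun t ↦ y t i := by fun_prop
    have h' := h.tendsto 0
    simp only [y, zero_mul, zero_smul, add_zero] at h'
    exact h'.mono_left nhdsWithin_le_nhds
  have hmem : ∀ᶠ t in 𝓝[≠] (0 : ℝ), ∀ i, y t i ∈ c.target :=
    Filter.eventually_all.2 fun i ↦ (hy i).eventually_mem
      (c.open_target.mem_nhds (c.map_source (ha i)))
  have hne : ∀ᶠ t in 𝓝[≠] (0 : ℝ), ∀ i j, i ≠ j → ℓ (y t i) ≠ ℓ (y t j) := by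
    refine Filter.eventually_all.2 fun i ↦ Filter.eventually_all.2 fun j ↦ ?_
    by_cases hij : i = j
    · simp [hij]
    have hij' : (i : ℝ) - j ≠ 0 := by
      rw [sub_ne_zero]
      exact_mod_cast fun h ↦ hij (Fin.ext h)
    have h1 : ∀ᶠ t in 𝓝[≠] (0 : ℝ), t ≠ (ℓ (c (a j)) - ℓ (c (a i))) / (i - j) := by
      by_cases h0 : (ℓ (c (a j)) - ℓ (c (a i))) / ((i : ℝ) - j) = 0
      · rw [h0]
        exact self_mem_nhdsWithin
      · exact nhdsWithin_le_nhds (isOpen_ne.mem_nhds (Ne.symm h0))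
    filter_upwards [h1] with t ht _ h2
    refine ht ?_
    simp only [y, map_add, map_smul, hv, smul_eq_mul, mul_one] at h2
    field_simp
    linarith
  have hlim : Filter.Tendsto (fun t i ↦ c.symm (y t i)) (𝓝[≠] 0) (𝓝 a) := by
    rw [tendsto_pi_nhds]
    intro i
    have h := (c.continuousAt_symm (c.map_source (ha i))).tendsto.comp (hy i)
    rwa [c.left_inv (ha i)] at h
  refine hlim.frequently (Filter.Eventually.frequently ?_)
  filter_upwards [hmem, hne] with t ht ht'
  refine ⟨fun i ↦ c.map_target (ht i), fun i j hij ↦ ?_⟩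
  by_contra hne'
  simp only [c.right_inv (ht _)] at hij
  exact ht' i j hne' hij

end Chart

variable {m : ℕ} {N : Type*} [TopologicalSpace N] [T2Space N]
  {E : Type*} [NormedAddCommGroup E] [NormedSpace ℝ E]

/-- A function on configurations that is symmetric, and locally constant on the configurations in
a chart ball, is constant on those. -/
theorem eq_of_eventually_eq_of_symmetric (c : OpenPartialHomeomorph N E) {ℓ : E →L[ℝ] ℝ} {v : E}
    (hv : ℓ v = 1) {b : Set E} (hb : IsOpen b) (hbc : Convex ℝ b) (hbt : b ⊆ c.target)
    {D : OrdConf m N → ℝ} (hD : ∀ (σ : Equiv.Perm (Fin m)) z, D (σ • z) = D z)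
    (hloc : ∀ z : OrdConf m N, (∀ i, z.1 i ∈ c.source ∩ c ⁻¹' b) → ∀ᶠ w in 𝓝 z, D w = D z)
    {z z' : OrdConf m N} (hz : ∀ i, z.1 i ∈ c.source ∩ c ⁻¹' b)
    (hz' : ∀ i, z'.1 i ∈ c.source ∩ c ⁻¹' b) : D z = D z' := by
  -- Ordering the points by `ℓ` cuts out a convex, hence connected, set of tuples, in every
  -- dimension.
  let U : Set (Fin m → E) := {y | (∀ i, y i ∈ b) ∧ ∀ i j, i < j → ℓ (y i) < ℓ (y j)}
  have hU : Convex ℝ U := by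
    intro y hy y' hy' s t hs ht hst
    refine ⟨fun i ↦ hbc (hy.1 i) (hy'.1 i) hs ht hst, fun i j hij ↦ ?_⟩
    have h1 := hy.2 i j hij
    have h2 := hy'.2 i j hij
    simp only [Pi.add_apply, Pi.smul_apply, map_add, map_smul, smul_eq_mul]
    -- A strict inequality needs one positive weight; if `s = 0`, then `t = 1`.
    rcases hs.eq_or_lt with rfl | hs
    · have : t = 1 := by linarith
      subst this
      linarith
    · nlinarith [mul_lt_mul_of_pos_left h1 hs, mul_le_mul_of_nonneg_left h2.le ht]
  have hinj : ∀ y ∈ U, Function.Injective fun i ↦ c.symm (y i) := by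
    intro y hy i j hij
    have h1 : y i = y j := c.symm.injOn (hbt (hy.1 i)) (hbt (hy.1 j)) hij
    by_contra hne
    rcases lt_or_gt_of_ne hne with h | h
    · exact (hy.2 i j h).ne (by rw [h1])
    · exact (hy.2 j i h).ne (by rw [h1])
  let ψ : U → OrdConf m N := fun y ↦ ⟨fun i ↦ c.symm (y.1 i), hinj y.1 y.2⟩
  have hψ : Continuous ψ := by
    refine Continuous.subtype_mk (continuous_pi fun i ↦ ?_) _
    exact c.continuousOn_symm.comp_continuous ((continuous_apply i).comp continuous_subtype_val)
      fun y ↦ hbt (y.2.1 i)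
  have hconst : ∀ y y' : U, D (ψ y) = D (ψ y') := by
    have : PreconnectedSpace U := Subtype.preconnectedSpace hU.isPreconnected
    have h : IsLocallyConstant (D ∘ ψ) := by
      rw [IsLocallyConstant.iff_eventually_eq]
      intro y
      refine hψ.continuousAt.eventually (hloc (ψ y) fun i ↦ ?_)
      have h1 := hbt (y.2.1 i)
      exact ⟨c.map_target h1, by simpa [ψ, c.right_inv h1] using y.2.1 i⟩
    exact fun y y' ↦ h.apply_eq_of_preconnectedSpace y y'
  -- Local constancy allows a small perturbation of `z` that makes the `ℓ`-values distinct; symmetry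
  -- then allows sorting the points by `ℓ`, which lands in `U`.
  have hred : ∀ z : OrdConf m N, (∀ i, z.1 i ∈ c.source ∩ c ⁻¹' b) → ∃ y : U, D z = D (ψ y) := by
    intro z hz
    have h1 := hloc z hz
    rw [nhds_subtype_eq_comap, Filter.eventually_comap] at h1
    have h2 : ∀ᶠ w in 𝓝 z.1, ∀ i, w i ∈ c.source ∩ c ⁻¹' b :=
      Filter.eventually_all.2 fun i ↦ (continuous_apply i).continuousAt.eventually
        ((c.isOpen_inter_preimage hb).mem_nhds (hz i))
    obtain ⟨w, ⟨hw1, hw2⟩, hw3, hw4⟩ :=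
      ((frequently_injective_chart c hv fun i ↦ (hz i).1).and_eventually (h1.and h2)).exists
    have hwi : Function.Injective w := fun i j hij ↦ hw2 (by simp only [hij])
    let f : Fin m → ℝ := fun i ↦ ℓ (c (w i))
    have hmono : StrictMono (f ∘ Tuple.sort f) :=
      (Tuple.monotone_sort f).strictMono_of_injective (hw2.comp (Tuple.sort f).injective)
    refine ⟨⟨fun i ↦ c (w (Tuple.sort f i)), fun i ↦ (hw4 _).2, fun i j hij ↦ hmono hij⟩, ?_⟩
    rw [← hw3 ⟨w, hwi⟩ rfl, ← hD (Tuple.sort f)⁻¹]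
    congr 1
    apply Subtype.ext
    funext i
    simp [ψ, smul_val, c.left_inv (hw4 _).1]
  obtain ⟨y, hy⟩ := hred z hz
  obtain ⟨y', hy'⟩ := hred z' hz'
  rw [hy, hy', hconst]

variable [ChartedSpace E N] [IsManifold 𝓘(ℝ, E) ∞ N]

/-- A symmetric primitive of `hat α` differs from the sum of a local primitive of `α` by a constant
on the configurations near a point. -/
theorem exists_eq_sum_add_const {ℓ : E →L[ℝ] ℝ} {v : E} (hv : ℓ v = 1)
    {α : DeRham.OneForm 𝓘(ℝ, E) N} {g : OrdConf m N → ℝ}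
    (hg : ∀ (σ : Equiv.Perm (Fin m)) z, g (σ • z) = g z)
    (hgα : ∀ z, HasMFDerivAt (piModel (Fin m) E) 𝓘(ℝ, ℝ) g z (hat α z)) {x : N} {f : N → ℝ}
    (hf : DeRham.IsPrimitiveNear 𝓘(ℝ, E) f α x) :
    ∃ B ∈ 𝓝 x, ∃ k : ℝ, ∀ z : OrdConf m N, (∀ i, z.1 i ∈ B) → g z = (∑ i, f (z.1 i)) + k := by
  let c := chartAt E x
  have h1 : Filter.Tendsto c.symm (𝓝 (c x)) (𝓝 x) := by
    have := c.continuousAt_symm (mem_chart_target E x)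
    rwa [ContinuousAt, c.left_inv (mem_chart_source E x)] at this
  obtain ⟨r, hr, hball⟩ := Metric.eventually_nhds_iff_ball.1
    ((h1.eventually hf).and (c.open_target.mem_nhds (mem_chart_target E x)))
  let B := c.source ∩ c ⁻¹' Metric.ball (c x) r
  have hBo : IsOpen B := c.isOpen_inter_preimage Metric.isOpen_ball
  have hB : ∀ y ∈ B, HasMFDerivAt 𝓘(ℝ, E) 𝓘(ℝ, ℝ) f y (α y) := by
    intro y hy
    have h := (hball _ hy.2).1.2
    rwa [c.left_inv hy.1] at h
  let D : OrdConf m N → ℝ := g - fun z ↦ ∑ i, f (z.1 i)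
  have hD : ∀ (σ : Equiv.Perm (Fin m)) z, D (σ • z) = D z := by
    intro σ z
    simp only [D, Pi.sub_apply, hg, smul_val]
    rw [Equiv.sum_comp σ⁻¹ fun i ↦ f (z.1 i)]
  have hder : ∀ z : OrdConf m N, (∀ i, z.1 i ∈ B) → HasMFDerivAt (piModel (Fin m) E) 𝓘(ℝ, ℝ) D z
      (0 : TangentSpace (piModel (Fin m) E) z →L[ℝ] ℝ) := by
    intro z hz
    have h := (hgα z).sub (hasMFDerivAt_sum_coord (f := fun _ ↦ f) fun i ↦ hB _ (hz i))
    rwa [sub_self] at h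
  have hloc : ∀ z : OrdConf m N, (∀ i, z.1 i ∈ B) → ∀ᶠ w in 𝓝 z, D w = D z := by
    intro z hz
    refine DeRham.eventually_eq_of_hasMFDerivAt_zero (I := piModel (Fin m) E) ?_
    have h2 : ∀ᶠ w in 𝓝 z, ∀ i, w.1 i ∈ B :=
      Filter.eventually_all.2 fun i ↦ (contMDiff_coord (E := E) i).continuous.continuousAt.eventually
        (hBo.mem_nhds (hz i))
    exact h2.mono hder
  refine ⟨B, hBo.mem_nhds ⟨mem_chart_source E x, Metric.mem_ball_self hr⟩, ?_⟩
  -- The constant is the value at any one configuration in `B`; the split avoids having to produce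
  -- one.
  by_cases hV : ∃ z : OrdConf m N, ∀ i, z.1 i ∈ B
  · obtain ⟨z', hz'⟩ := hV
    refine ⟨D z', fun z hz ↦ ?_⟩
    have h : D z = D z' := eq_of_eventually_eq_of_symmetric c hv Metric.isOpen_ball
      (convex_ball (c x) r) (fun y hy ↦ (hball y hy).2) hD hloc hz hz'
    rw [← h]
    simp [D]
  · exact ⟨0, fun z hz ↦ (hV ⟨z, hz⟩).elim⟩

/-- A locally exact form `α` is exact as soon as `hat α` has a symmetric primitive. The primitive of
`α` is, up to the factor `m`, the extension of that of `hat α` to the diagonal. -/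
theorem exists_primitive_of_hat (hm : 1 ≤ m) [Nontrivial E]
    {α : DeRham.OneForm 𝓘(ℝ, E) N} (hα : DeRham.IsLocallyExact 𝓘(ℝ, E) α) {g : OrdConf m N → ℝ}
    (hg : ∀ (σ : Equiv.Perm (Fin m)) z, g (σ • z) = g z)
    (hgα : ∀ z, HasMFDerivAt (piModel (Fin m) E) 𝓘(ℝ, ℝ) g z (hat α z)) :
    ∃ h : N → ℝ, ∀ x, ContMDiffAt 𝓘(ℝ, E) 𝓘(ℝ, ℝ) ∞ h x ∧
      HasMFDerivAt 𝓘(ℝ, E) 𝓘(ℝ, ℝ) h x (α x) := by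
  obtain ⟨v₀, hv₀⟩ := exists_ne (0 : E)
  obtain ⟨ℓ, hv⟩ := SeparatingDual.exists_eq_one (R := ℝ) hv₀
  choose f hf using hα
  choose B hB k hk using fun x ↦ exists_eq_sum_add_const hv hg hgα (hf x)
  have hm0 : (m : ℝ) ≠ 0 := by
    have : 0 < m := hm
    positivity
  -- Independence of the base point of the local primitive. Continuity of `f x` at `y` is assumed
  -- because `f x` is controlled only near `x`.
  have key : ∀ x y, B x ∈ 𝓝 y → ContinuousAt (f x) y → f y y + k y / m = f x y + k x / m := by
    intro x y hyx hc
    have hcy : ContinuousAt (f y) y := (hf y).self_of_nhds.1.continuousAt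
    have hsum : ∀ x, ContinuousAt (f x) y → Filter.Tendsto
        (fun w : Fin m → N ↦ (∑ i, f x (w i)) + k x) (𝓝 fun _ ↦ y) (𝓝 (m * f x y + k x)) := by
      intro x hc
      have h : Filter.Tendsto (fun w : Fin m → N ↦ ∑ i, f x (w i)) (𝓝 fun _ ↦ y)
          (𝓝 (∑ _i : Fin m, f x y)) :=
        tendsto_finsetSum _ fun i _ ↦
          hc.tendsto.comp ((continuous_apply i).tendsto (fun _ : Fin m ↦ y))
      simpa using h.add_const (k x)
    have hmem : ∀ x, B x ∈ 𝓝 y → ∀ᶠ w in 𝓝 (fun _ : Fin m ↦ y), ∀ i, w i ∈ B x := fun x hx ↦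
      Filter.eventually_all.2 fun i ↦
        ((continuous_apply i).tendsto (fun _ : Fin m ↦ y)).eventually_mem hx
    have hfreq := (frequently_injective_chart (chartAt E y) hv
      (fun _ : Fin m ↦ mem_chart_source E y)).and_eventually ((hmem x hyx).and (hmem y (hB y)))
    -- Both sides are limits of expressions that equal `g` on configurations of distinct points in
    -- `B x ∩ B y`, and such configurations accumulate at the diagonal point `(y, …, y)`.
    have h : m * f y y + k y = m * f x y + k x := by
      refine tendsto_nhds_unique_of_frequently_eq (hsum y hcy) (hsum x hc) (hfreq.mono ?_)
      rintro w ⟨⟨-, hw⟩, hwx, hwy⟩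
      have hwi : Function.Injective w := fun i j hij ↦ hw (by simp only [hij])
      rw [← hk x ⟨w, hwi⟩ hwx, ← hk y ⟨w, hwi⟩ hwy]
    field_simp
    linarith
  -- This is the diagonal limit of `g / m`. By `key` it agrees near `x` with `f x` plus a constant.
  refine ⟨fun x ↦ f x x + k x / m, fun x ↦ ?_⟩
  have heq : (fun x ↦ f x x + k x / m) =ᶠ[𝓝 x] fun y ↦ f x y + k x / m := by
    filter_upwards [eventually_mem_nhds_iff.2 (hB x), hf x] with y hy hy'
    exact key x y hy hy'.1.continuousAt
  have hx := (hf x).self_of_nhds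
  refine ⟨(hx.1.add contMDiffAt_const).congr_of_eventuallyEq heq, ?_⟩
  have h := hx.2.add (hasMFDerivAt_const (I := 𝓘(ℝ, E)) (I' := 𝓘(ℝ, ℝ)) (k x / m) x)
  have h0 : (α x : E →L[ℝ] ℝ) + 0 = α x := add_zero _
  exact (h0 ▸ h : HasMFDerivAt 𝓘(ℝ, E) 𝓘(ℝ, ℝ) _ x (α x)).congr_of_eventuallyEq heq

end Conf

/-! ### The induced map on first cohomology -/

namespace Conf
variable {m : ℕ} {N : Type*} [TopologicalSpace N] [T2Space N]
  {E : Type*} [NormedAddCommGroup E] [NormedSpace ℝ E] [FiniteDimensional ℝ E]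
  [ChartedSpace E N] [IsManifold 𝓘(ℝ, E) ∞ N]

theorem descend_add (α β : DeRham.OneForm 𝓘(ℝ, E) N) (q : UConf m N) :
    descend (α + β) q = descend α q + descend β q := by
  have h : ∀ x : OrdConf m N, hat (α + β) x = hat α x + hat β x := by
    intro x
    rw [hat, hat, hat, ← Finset.sum_add_distrib]
    exact Finset.sum_congr rfl fun i _ ↦ ContinuousLinearMap.add_comp _ _ _
  rw [descend, h]
  exact ContinuousLinearMap.add_comp _ _ _

theorem descend_smul (r : ℝ) (α : DeRham.OneForm 𝓘(ℝ, E) N) (q : UConf m N) :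
    descend (r • α) q = r • descend α q := by
  have h : ∀ x : OrdConf m N, hat (r • α) x = r • hat α x := by
    intro x
    rw [hat, hat, Finset.smul_sum]
    exact Finset.sum_congr rfl fun i _ ↦ ContinuousLinearMap.smul_comp _ _ _
  rw [descend, h]
  exact ContinuousLinearMap.smul_comp _ _ _

theorem isLocallyExact_descend {α : DeRham.OneForm 𝓘(ℝ, E) N}
    (hα : DeRham.IsLocallyExact 𝓘(ℝ, E) α) :
    DeRham.IsLocallyExact (piModel (Fin m) E) (fun q : UConf m N ↦ descend α q) :=
  (isLocallyExact_hat hα).of_comp_isLocalDiffeomorph isLocalDiffeomorph_proj proj_surjective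
    (descend_comp_mfderiv_proj α)

variable (m N E) in
/-- The linear map sending a closed form `α` to the closed form on the unordered configuration space
whose pullback is `hat α`. -/
def descendClosed : DeRham.ClosedOneForm 𝓘(ℝ, E) N →ₗ[ℝ]
    DeRham.ClosedOneForm (piModel (Fin m) E) (UConf m N) where
  toFun α :=
    have h := isLocallyExact_descend (m := m)
      (DeRham.isLocallyExact_of_dOne_eq_zero (LinearMap.mem_ker.1 α.2))
    ⟨⟨fun q ↦ descend α.1 q, h.contMDiff⟩,
      LinearMap.mem_ker.2 (DeRham.dOne_eq_zero_of_isLocallyExact _ h)⟩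
  map_add' α β := by
    apply Subtype.ext
    ext q : 1
    exact descend_add α.1 β.1 q
  map_smul' r α := by
    apply Subtype.ext
    ext q : 1
    exact descend_smul r α.1 q

theorem pullProj_descendClosed (α : DeRham.ClosedOneForm 𝓘(ℝ, E) N) (x : OrdConf m N) :
    pullProj (descendClosed m N E α).1 x = hat α.1 x :=
  descend_comp_mfderiv_proj α.1 x

/-- A form on the unordered configuration space is determined by its pullback. -/
theorem pullProj_injective {η θ : DeRham.OneForm (piModel (Fin m) E) (UConf m N)}
    (h : ∀ x : OrdConf m N, pullProj η x = pullProj θ x) : η = θ := by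
  ext q : 1
  obtain ⟨x, rfl⟩ := proj_surjective q
  let L := (isLocalDiffeomorph_proj (E := E) x).mfderivToContinuousLinearEquiv (by simp)
  ext v
  have h1 := congrArg (fun A ↦ A (L.symm v)) (h x)
  have h2 : mfderiv (piModel (Fin m) E) (piModel (Fin m) E) proj x (L.symm v) = v :=
    L.apply_symm_apply v
  have h3 : η (proj x) (mfderiv (piModel (Fin m) E) (piModel (Fin m) E) proj x (L.symm v)) =
      θ (proj x) (mfderiv (piModel (Fin m) E) (piModel (Fin m) E) proj x (L.symm v)) := h1
  rwa [h2] at h3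

theorem hasMFDerivAt_comp_proj (f : C^∞⟮piModel (Fin m) E, UConf m N; ℝ⟯) (x : OrdConf m N) :
    HasMFDerivAt (piModel (Fin m) E) 𝓘(ℝ, ℝ) (f ∘ proj) x
      (pullProj (DeRham.dZero _ _ f) x) :=
  ((f.contMDiff (proj x)).mdifferentiableAt (by simp)).hasMFDerivAt.comp x
    ((isLocalDiffeomorph_proj (E := E) x).mdifferentiableAt (by simp)).hasMFDerivAt

/-- The sum of a primitive over the points of a configuration is symmetric and smooth, so it
descends; primitives are compared after pullback. This makes the map on cohomology well defined. -/
theorem descendClosed_mem_range {α : DeRham.ClosedOneForm 𝓘(ℝ, E) N}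
    (hα : α.1 ∈ LinearMap.range (DeRham.dZero 𝓘(ℝ, E) N)) :
    (descendClosed m N E α).1 ∈ LinearMap.range (DeRham.dZero (piModel (Fin m) E) (UConf m N)) := by
  obtain ⟨h, hh⟩ := hα
  let s : OrdConf m N → ℝ := fun x ↦ ∑ i, h (x.1 i)
  have hs : ContMDiff (piModel (Fin m) E) 𝓘(ℝ, ℝ) ∞ s :=
    contMDiff_finsetSum fun i _ ↦ h.contMDiff.comp (contMDiff_coord i)
  have hsym : ∀ x y : OrdConf m N, MulAction.orbitRel (Equiv.Perm (Fin m)) _ x y → s x = s y := by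
    rintro _ y ⟨σ, rfl⟩
    exact Equiv.sum_comp σ⁻¹ fun i ↦ h (y.1 i)
  let f : UConf m N → ℝ := Quotient.lift s hsym
  have hf : ContMDiff (piModel (Fin m) E) 𝓘(ℝ, ℝ) ∞ f :=
    DeRham.contMDiff_of_comp_isLocalDiffeomorph isLocalDiffeomorph_proj proj_surjective hs
  refine ⟨⟨f, hf⟩, pullProj_injective fun x ↦ ?_⟩
  rw [pullProj_descendClosed]
  refine hasMFDerivAt_unique (hasMFDerivAt_comp_proj ⟨f, hf⟩ x) (hasMFDerivAt_sum_coord fun i ↦ ?_)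
  rw [← hh]
  exact ((h.contMDiff (x.1 i)).mdifferentiableAt (by simp)).hasMFDerivAt

/-- The injectivity statement at the level of forms: a primitive downstairs composed with `proj` is
a symmetric primitive of `hat α`, so `exists_primitive_of_hat` applies. -/
theorem mem_range_of_descendClosed_mem_range [Nontrivial E] (hm : 1 ≤ m)
    {α : DeRham.ClosedOneForm 𝓘(ℝ, E) N}
    (hα : (descendClosed m N E α).1 ∈
      LinearMap.range (DeRham.dZero (piModel (Fin m) E) (UConf m N))) :
    α.1 ∈ LinearMap.range (DeRham.dZero 𝓘(ℝ, E) N) := by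
  obtain ⟨f, hf⟩ := hα
  obtain ⟨h, hh⟩ := exists_primitive_of_hat hm
    (DeRham.isLocallyExact_of_dOne_eq_zero (LinearMap.mem_ker.1 α.2)) (g := f ∘ proj)
    (fun σ z ↦ congrArg f (proj_eq_iff.2 ⟨σ, rfl⟩)) (fun z ↦ by
      rw [← pullProj_descendClosed, ← hf]
      exact hasMFDerivAt_comp_proj f z)
  refine ⟨⟨h, fun x ↦ (hh x).1⟩, ?_⟩
  ext x : 1
  exact (hh x).2.mfderiv

end Conf
end

theorem mainTheorem3 {E : Type*} [NormedAddCommGroup E] [NormedSpace ℝ E] [FiniteDimensional ℝ E]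
    (hE : 1 ≤ Module.finrank ℝ E)
    {N : Type*} [TopologicalSpace N] [T2Space N] [ChartedSpace E N] [IsManifold 𝓘(ℝ, E) ∞ N]
    (m : ℕ) (hm : 1 ≤ m) :
    ∃ Φ : DeRham.H1 𝓘(ℝ, E) N →ₗ[ℝ] DeRham.H1 (Conf.piModel (Fin m) E) (Conf.UConf m N),
      Function.Injective Φ ∧
      ∀ α : DeRham.ClosedOneForm 𝓘(ℝ, E) N,
        ∃ η : DeRham.ClosedOneForm (Conf.piModel (Fin m) E) (Conf.UConf m N),
          (∀ x : Conf.OrdConf m N, Conf.pullProj η.1 x = Conf.hat α.1 x) ∧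
          Φ (DeRham.H1.mk α) = DeRham.H1.mk η := by
  have : Nontrivial E := Module.nontrivial_of_finrank_pos (R := ℝ) hE
  refine ⟨Submodule.mapQ _ _ (Conf.descendClosed m N E) fun α hα ↦
    Conf.descendClosed_mem_range hα, ?_, fun α ↦
    ⟨Conf.descendClosed m N E α, Conf.pullProj_descendClosed α, rfl⟩⟩
  rw [injective_iff_map_eq_zero]
  intro a ha
  obtain ⟨α, rfl⟩ := Submodule.mkQ_surjective _ a
  have hη : Conf.descendClosed m N E α ∈ Submodule.submoduleOf _ _ :=
    (Submodule.Quotient.mk_eq_zero _).1 ha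
  refine (Submodule.Quotient.mk_eq_zero _).2 ?_
  exact Conf.mem_range_of_descendClosed_mem_range hm hη
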